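/- Let $G=(V,E)$ be a finite simple graph and $0<p\le 1$. A realization $G_p$ of $G$ keeps each edge of $G$ independently with probability $p$, and $\mathrm{OPT}(G)$ denotes the expected size of a maximum matching in $G_p$; for a subgraph $H$ of $G$, $\mathrm{OPT}(H)$ is defined in the same way. For $\varepsilon>0$, $\mathrm{MatchingCover}(G,\varepsilon)$ is the following procedure: for $i=1,\dots,R$, where $R=\left\lceil C\,\frac{\log(1/(\varepsilon p))}{\varepsilon p}\right\rceil$, let $M_i$ be a maximum matching of the graph $(V,E\setminus(M_1\cup\dots\cup M_{i-1}))$ (ties are broken arbitrarily); return $(M_1,\dots,M_R)$. There is an absolute constant $C_0>0$ such that the following holds for every constant $C\ge C_0$ in the number of rounds. Let $p_0>0$, let $p_0\le p\le 1$, and let $G=(V,E)$ be any finite simple graph. Let $M$ be any maximum matching of $G$, let $(M_1,\dots,M_R)$ be any result of $\mathrm{MatchingCover}\big((V,E\setminus M),\varepsilon\big)$ with $\varepsilon=p_0^2/10^4$, and let $H=(V,\,M\cup M_1\cup\dots\cup M_R)$. Then the expected maximum matching size of a realization $H_p$ of $H$ satisfies $$\mathrm{OPT}(H)\;\ge\;\Big(\frac12+\frac{p^2}{4}-\frac{p_0^2}{10^4}\Big)\cdot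 \mathrm{OPT}(G).$$ -/

import Mathlib

/-- `S` is (the edge set of) a matching of `G`. -/
def IsMatchingOf {V : Type*} (G : SimpleGraph V) (S : Set (Sym2 V)) : Prop :=
  ∃ N : G.Subgraph, N.IsMatching ∧ N.edgeSet = S

/-- `S` is a maximum (i.e. maximum-cardinality) matching of `G`. -/
def IsMaximumMatchingOf {V : Type*} (G : SimpleGraph V) (S : Set (Sym2 V)) : Prop :=
  IsMatchingOf G S ∧ ∀ T : Set (Sym2 V), IsMatchingOf G T → T.ncard ≤ S.ncard

/-- The maximum matching size of `G`. -/
noncomputable def maxMatchingSize {V : Type*} (G : SimpleGraph V) : ℕ :=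
  sSup {k : ℕ | ∃ S : Set (Sym2 V), IsMatchingOf G S ∧ S.ncard = k}

open scoped Classical in
/-- `opt(G)`: the expected maximum matching size of a realization `G_p` of `G`, in which each edge
of `G` is present independently with probability `p`. The set of realized edges equals
`F ⊆ E(G)` with probability `p ^ |F| * (1 - p) ^ |E(G) \ F|`. -/
noncomputable def expectedMatchingSize {V : Type*} [Fintype V] (G : SimpleGraph V) (p : ℝ) : ℝ :=
  ∑ F ∈ G.edgeFinset.powerset,
    p ^ F.card * (1 - p) ^ (G.edgeFinset \ F).card *
      (maxMatchingSize (SimpleGraph.fromEdgeSet (F : Set (Sym2 V))) : ℝ)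

/-- The number `R = Θ(log(1/(εp)) / (εp))` of rounds of `MatchingCover`, where `C` is the constant
hidden in the `Θ`. -/
noncomputable def matchingCoverRounds (C ε p : ℝ) : ℕ :=
  ⌈C * (Real.log (1 / (ε * p)) / (ε * p))⌉₊

/-- `(M 0, …, M (R - 1))` is a possible result of `R` rounds of `MatchingCover` on `G`: each
`M i` is a maximum matching of the graph that remains after the edges of all earlier matchings
have been removed. Ties between maximum matchings may be broken in any way. -/
def IsMatchingCover {V : Type*} (G : SimpleGraph V) (R : ℕ) (M : Fin R → Set (Sym2 V)) : Prop :=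
  ∀ i : Fin R, IsMaximumMatchingOf (G.deleteEdges (⋃ j : Fin R, ⋃ _ : j < i, M j)) (M i)

/-- `H` is a possible output of the algorithm on input `G` and `p`: `H` consists of the edges of
one maximum matching `M` of `G` and of the edges of a matching cover of `G(V, E \ M)`
with the parameter `ε = p₀ ^ 2 / 10 ^ 4`. -/
def IsAlgorithmOutput {V : Type*} (C p₀ p : ℝ) (G H : SimpleGraph V) : Prop :=
  ∃ (M : Set (Sym2 V))
    (N : Fin (matchingCoverRounds C (p₀ ^ 2 / 10 ^ 4) p) → Set (Sym2 V)),
    IsMaximumMatchingOf G M ∧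
    IsMatchingCover (G.deleteEdges M) (matchingCoverRounds C (p₀ ^ 2 / 10 ^ 4) p) N ∧
    H = SimpleGraph.fromEdgeSet (M ∪ ⋃ i, N i)

open Finset

/-! Write T = OPT(G), Y = OPT(H), let Q be the union of the cover matchings and L the size of the
last, smallest one. Edges outside H were still available in the last round, so they contain no
matching larger than L; hence T ≤ Y + L. Conversely, realize M and add those edges of a maximum
matching of the realized Q that avoid the realized part of M. Each such edge meets at most two edges
of M, so Y ≥ p|M| + (1-p)²·E[ν(Q_p)], where ν is the matching number. Given E[ν(Q_p)] ≥ min(L, T) -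
2εT, balancing the two bounds gives the ratio (`approximation_ratio`).

The main work is this bound on E[ν(Q_p)] (`le_mean_matchingNumber_biUnion`). By a Tutte–Berge
argument (`exists_coverGraph`), ν(Q_p) ≤ k is certified by a set U of vertices and a set F of
realized edges, at most 4k objects in all, whose cover graph contains every realized edge and has
matching number at most k. If k is below min(L, T) - εT, every matching of the cover has at least
max(1, εT) edges outside the cover graph, and all of these must be unrealized. With R disjoint
matchings this is so unlikely that a union bound over certificates succeeds (`tail_bound`,
`rounds_estimate`). -/

/-- No two distinct members of `S` share a vertex. -/
def VertexDisjoint {V : Type*} (S : Set (Sym2 V)) : Prop :=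
  ∀ e ∈ S, ∀ f ∈ S, ∀ v, v ∈ e → v ∈ f → e = f

lemma VertexDisjoint.mono {V : Type*} {S T : Set (Sym2 V)} (h : VertexDisjoint T) (hST : S ⊆ T) :
    VertexDisjoint S :=
  fun e he f hf v hve hvf => h e (hST he) f (hST hf) v hve hvf

lemma isMatchingOf_iff {V : Type*} {G : SimpleGraph V} {S : Set (Sym2 V)} :
    IsMatchingOf G S ↔ S ⊆ G.edgeSet ∧ VertexDisjoint S := by
  constructor
  · rintro ⟨N, hN, rfl⟩
    refine ⟨N.edgeSet_subset, fun e he f hf v hve hvf => ?_⟩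
    obtain ⟨a, rfl⟩ := Sym2.mem_iff_exists.1 hve
    obtain ⟨b, rfl⟩ := Sym2.mem_iff_exists.1 hvf
    rw [SimpleGraph.Subgraph.mem_edgeSet] at he hf
    rw [hN.eq_of_adj_left he hf]
  · rintro ⟨hS, hd⟩
    refine ⟨⟨{v | ∃ e ∈ S, v ∈ e}, fun a b => s(a, b) ∈ S, fun h => hS h,
      fun h => ⟨_, h, Sym2.mem_mk_left _ _⟩, ⟨fun a b h => by rwa [Sym2.eq_swap]⟩⟩, ?_, ?_⟩
    · rintro v ⟨e, he, hve⟩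
      obtain ⟨a, rfl⟩ := Sym2.mem_iff_exists.1 hve
      refine ⟨a, he, fun b hb => ?_⟩
      have := hd _ hb _ he v (Sym2.mem_mk_left _ _) (Sym2.mem_mk_left _ _)
      exact Sym2.congr_right.1 this
    · ext e
      induction e with
      | _ a b => rfl

/-! ### Matchings as edge sets, and the matching number -/

section Basic

variable {V : Type*} {G G' : SimpleGraph V}

lemma IsMatchingOf.mono {S : Set (Sym2 V)} (h : IsMatchingOf G S) (hG : G ≤ G') :
    IsMatchingOf G' S := by
  rw [isMatchingOf_iff] at h ⊢
  exact ⟨h.1.trans (SimpleGraph.edgeSet_mono hG), h.2⟩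

lemma IsMatchingOf.subset {S T : Set (Sym2 V)} (h : IsMatchingOf G T) (hST : S ⊆ T) :
    IsMatchingOf G S := by
  rw [isMatchingOf_iff] at h ⊢
  exact ⟨hST.trans h.1, h.2.mono hST⟩

lemma isMatchingOf_empty : IsMatchingOf G ∅ := by
  rw [isMatchingOf_iff]
  exact ⟨Set.empty_subset _, fun e he => he.elim⟩

variable [Finite V]

lemma bddAbove_matchingSizes :
    BddAbove {k : ℕ | ∃ S : Set (Sym2 V), IsMatchingOf G S ∧ S.ncard = k} := by
  refine ⟨(Set.univ : Set (Sym2 V)).ncard, ?_⟩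
  rintro k ⟨S, -, rfl⟩
  exact Set.ncard_le_ncard (Set.subset_univ _) (Set.toFinite _)

lemma IsMatchingOf.ncard_le {S : Set (Sym2 V)} (h : IsMatchingOf G S) :
    S.ncard ≤ maxMatchingSize G :=
  le_csSup bddAbove_matchingSizes ⟨S, h, rfl⟩

lemma IsMatchingOf.card_le {S : Finset (Sym2 V)} (h : IsMatchingOf G (S : Set (Sym2 V))) :
    S.card ≤ maxMatchingSize G := by
  simpa using h.ncard_le

lemma exists_isMatchingOf_card_eq (G : SimpleGraph V) :
    ∃ S : Finset (Sym2 V), IsMatchingOf G (S : Set (Sym2 V)) ∧ S.card = maxMatchingSize G := by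
  obtain ⟨S, hS, hk⟩ := Nat.sSup_mem
    (s := {k : ℕ | ∃ S : Set (Sym2 V), IsMatchingOf G S ∧ S.ncard = k})
    ⟨0, ∅, isMatchingOf_empty, by simp⟩ bddAbove_matchingSizes
  refine ⟨(Set.toFinite S).toFinset, by simpa using hS, ?_⟩
  rw [← Set.ncard_eq_toFinset_card S]
  exact hk

lemma maxMatchingSize_mono (h : G ≤ G') : maxMatchingSize G ≤ maxMatchingSize G' := by
  obtain ⟨S, hS, hc⟩ := exists_isMatchingOf_card_eq G
  exact hc ▸ (hS.mono h).card_le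

lemma IsMaximumMatchingOf.ncard_eq {S : Set (Sym2 V)} (h : IsMaximumMatchingOf G S) :
    S.ncard = maxMatchingSize G := by
  refine le_antisymm h.1.ncard_le ?_
  obtain ⟨T, hT, hc⟩ := exists_isMatchingOf_card_eq G
  rw [← hc, ← Set.ncard_coe_finset]
  exact h.2 _ hT

end Basic

/-! ### Covered vertices and Gallai's lemma -/

section Covered

variable {V : Type*} [DecidableEq V]

/-- The vertices that lie on an edge of `S`. -/
def coveredVertices (S : Finset (Sym2 V)) : Finset V := S.biUnion Sym2.toFinset

lemma mem_coveredVertices {S : Finset (Sym2 V)} {v : V} :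
    v ∈ coveredVertices S ↔ ∃ e ∈ S, v ∈ e := by
  simp [coveredVertices]

lemma card_coveredVertices_le (S : Finset (Sym2 V)) : (coveredVertices S).card ≤ 2 * S.card := by
  rw [mul_comm]
  refine card_biUnion_le_card_mul _ _ _ fun e _ => ?_
  rw [Sym2.card_toFinset]
  split_ifs <;> simp

lemma IsMatchingOf.card_coveredVertices {G : SimpleGraph V} {S : Finset (Sym2 V)}
    (h : IsMatchingOf G (S : Set (Sym2 V))) : (coveredVertices S).card = 2 * S.card := by
  rw [isMatchingOf_iff] at h
  rw [coveredVertices, card_biUnion, sum_const_nat (m := 2), mul_comm]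
  · intro e he
    exact Sym2.card_toFinset_of_not_isDiag _ (G.not_isDiag_of_mem_edgeSet (h.1 he))
  · intro e he f hf hne
    rw [Function.onFun, disjoint_left]
    intro v hve hvf
    exact hne (h.2 e he f hf v (Sym2.mem_toFinset.1 hve) (Sym2.mem_toFinset.1 hvf))

lemma IsMatchingOf.insert {G : SimpleGraph V} {S : Finset (Sym2 V)}
    (h : IsMatchingOf G (S : Set (Sym2 V))) {a b : V} (hab : G.Adj a b)
    (ha : a ∉ coveredVertices S) (hb : b ∉ coveredVertices S) :
    IsMatchingOf G ((insert s(a, b) S : Finset (Sym2 V)) : Set (Sym2 V)) := by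
  rw [isMatchingOf_iff] at h ⊢
  rw [mem_coveredVertices] at ha hb
  push Not at ha hb
  refine ⟨?_, ?_⟩
  · rw [coe_insert, Set.insert_subset_iff]
    exact ⟨hab, h.1⟩
  · intro e he f hf v hve hvf
    rw [mem_coe, mem_insert] at he hf
    have key : ∀ g ∈ S, v ∈ s(a, b) → v ∉ g := by
      intro g hg hv
      rcases Sym2.mem_iff.1 hv with rfl | rfl
      exacts [ha g hg, hb g hg]
    rcases he with rfl | he <;> rcases hf with rfl | hf
    · rfl
    · exact (key f hf hve hvf).elim
    · exact (key e he hvf hve).elim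
    · exact h.2 e he f hf v hve hvf

/-- `S` is a maximum matching of `G` in terms of the matching number. -/
def IsMaxMatching (G : SimpleGraph V) (S : Finset (Sym2 V)) : Prop :=
  IsMatchingOf G (S : Set (Sym2 V)) ∧ S.card = maxMatchingSize G

lemma notMem_of_notMem_coveredVertices {S : Finset (Sym2 V)} {v : V} {e : Sym2 V} (hv : v ∈ e)
    (h : v ∉ coveredVertices S) : e ∉ S :=
  fun he => h (mem_coveredVertices.2 ⟨e, he, hv⟩)

variable [Finite V]

lemma IsMaxMatching.covers_of_adj {G : SimpleGraph V} {S : Finset (Sym2 V)}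
    (h : IsMaxMatching G S) {a b : V} (hab : G.Adj a b) (ha : a ∉ coveredVertices S) :
    b ∈ coveredVertices S := by
  by_contra hb
  have h1 := (h.1.insert hab ha hb).card_le
  rw [card_insert_of_notMem (notMem_of_notMem_coveredVertices (Sym2.mem_mk_left a b) ha), h.2] at h1
  omega

/-- **Gallai's lemma**: on the vertices that are missed by some maximum matching, the relation
"no maximum matching misses both" is transitive. -/
lemma IsMaxMatching.gallai {G : SimpleGraph V} {x y z : V} (hxz : x ≠ z)
    (hxy : ∀ S, IsMaxMatching G S → y ∉ coveredVertices S → x ∈ coveredVertices S)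
    (hzy : ∀ S, IsMaxMatching G S → y ∉ coveredVertices S → z ∈ coveredVertices S)
    (hy : ∃ S, IsMaxMatching G S ∧ y ∉ coveredVertices S)
    {M : Finset (Sym2 V)} (hM : IsMaxMatching G M) (hx : x ∉ coveredVertices M) :
    z ∈ coveredVertices M := by
  classical
  have := Fintype.ofFinite V
  by_contra hz
  -- Extremal choice: among the maximum matchings missing `y`, `N` shares the most edges with `M`.
  -- An exchange will increase the overlap.
  obtain ⟨N, hN, hmax⟩ := exists_max_image
    (univ.filter fun S : Finset (Sym2 V) => IsMaxMatching G S ∧ y ∉ coveredVertices S)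
    (fun S => (M ∩ S).card) (by obtain ⟨S, hS⟩ := hy; exact ⟨S, by simpa using hS⟩)
  simp only [mem_filter, mem_univ, true_and] at hN hmax
  obtain ⟨hN, hyN⟩ := hN
  have hcard : (coveredVertices M \ coveredVertices N).card
      = (coveredVertices N \ coveredVertices M).card := by
    apply card_sdiff_comm
    rw [hM.1.card_coveredVertices, hN.1.card_coveredVertices, hM.2, hN.2]
  -- `N` misses `y`, so it covers both `x` and `z`, which `M` misses. By equal cardinality `M`
  -- covers two vertices that `N` misses, one of them different from `y`.
  have h2 : 1 < (coveredVertices N \ coveredVertices M).card :=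
    one_lt_card.2 ⟨x, mem_sdiff.2 ⟨hxy N hN hyN, hx⟩, z, mem_sdiff.2 ⟨hzy N hN hyN, hz⟩, hxz⟩
  rw [← hcard] at h2
  obtain ⟨t, ht, hty⟩ := exists_mem_ne h2 y
  rw [mem_sdiff] at ht
  obtain ⟨htM, htN⟩ := ht
  obtain ⟨e, heM, hte⟩ := mem_coveredVertices.1 htM
  obtain ⟨s, rfl⟩ := Sym2.mem_iff_exists.1 hte
  have hM' := isMatchingOf_iff.1 hM.1
  have hadj : G.Adj t s := hM'.1 heM
  have hsN := hN.covers_of_adj hadj htN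
  obtain ⟨f, hfN, hsf⟩ := mem_coveredVertices.1 hsN
  have heN : s(t, s) ∉ N := notMem_of_notMem_coveredVertices (Sym2.mem_mk_left t s) htN
  have hfM : f ∉ M := by
    intro hfM
    have := hM'.2 _ hfM _ heM s hsf (Sym2.mem_mk_right t s)
    exact heN (this ▸ hfN)
  have hN' := isMatchingOf_iff.1 hN.1
  have htE : t ∉ coveredVertices (N.erase f) := fun h =>
    htN (biUnion_subset_biUnion_of_subset_left _ (erase_subset f N) h)
  have hsE : s ∉ coveredVertices (N.erase f) := by
    intro h
    obtain ⟨g, hg, hsg⟩ := mem_coveredVertices.1 h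
    exact (mem_erase.1 hg).1 (hN'.2 g (mem_of_mem_erase hg) f hfN s hsg hsf)
  have hNE : IsMatchingOf G ((N.erase f : Finset (Sym2 V)) : Set (Sym2 V)) :=
    hN.1.subset (coe_subset.2 (erase_subset f N))
  have hnew := hNE.insert hadj htE hsE
  have heE : s(t, s) ∉ N.erase f := fun h => heN (mem_of_mem_erase h)
  -- Replacing `f` by `s(t, s)` uncovers only the other end of `f` and newly covers only `t ≠ y`, so
  -- `y` stays missed.
  have hle := hmax (insert s(t, s) (N.erase f)) ⟨⟨hnew, by
    rw [card_insert_of_notMem heE, card_erase_add_one hfN, hN.2]⟩, by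
    intro h
    obtain ⟨g, hg, hyg⟩ := mem_coveredVertices.1 h
    rcases mem_insert.1 hg with rfl | hg
    · rcases Sym2.mem_iff.1 hyg with rfl | rfl
      · exact hty rfl
      · exact hyN hsN
    · exact hyN (mem_coveredVertices.2 ⟨g, mem_of_mem_erase hg, hyg⟩)⟩
  have : insert s(t, s) (M ∩ N) ⊆ M ∩ insert s(t, s) (N.erase f) := by
    intro g hg
    rcases mem_insert.1 hg with rfl | hg
    · exact mem_inter.2 ⟨heM, mem_insert_self _ _⟩
    · rw [mem_inter] at hg
      refine mem_inter.2 ⟨hg.1, mem_insert_of_mem (mem_erase.2 ⟨?_, hg.2⟩)⟩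
      rintro rfl
      exact hfM hg.1
  have h3 := card_le_card this
  rw [card_insert_of_notMem fun h => heN (mem_inter.1 h).2] at h3
  omega

end Covered

/-! ### Small certificates for the matching number -/

section Witness

variable {V : Type*}

/-- Two distinct vertices are adjacent if one of them lies in `U` or if they are connected by
edges of `F`. -/
def coverGraph (U : Finset V) (F : Finset (Sym2 V)) : SimpleGraph V where
  Adj a b := a ≠ b ∧ (a ∈ U ∨ b ∈ U ∨
    (SimpleGraph.fromEdgeSet (F : Set (Sym2 V))).Reachable a b)
  symm := ⟨fun _ _ h => ⟨h.1.symm, by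
    rcases h.2 with h | h | h
    exacts [Or.inr (Or.inl h), Or.inl h, Or.inr (Or.inr h.symm)]⟩⟩
  loopless := ⟨fun _ h => h.1 rfl⟩

/-- Every edge set has a subset with the same connectivity that is a forest, in the sense that it
has at most as many edges as there are vertices outside any set of mutually disconnected
vertices. -/
lemma exists_forest [Fintype V] (E : Finset (Sym2 V)) :
    ∃ F ⊆ E, (∀ a b, s(a, b) ∈ E →
        (SimpleGraph.fromEdgeSet (F : Set (Sym2 V))).Reachable a b) ∧
      ∀ W : Finset V, (∀ a ∈ W, ∀ b ∈ W,
        (SimpleGraph.fromEdgeSet (F : Set (Sym2 V))).Reachable a b → a = b) →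
        F.card + W.card ≤ Fintype.card V := by
  classical
  induction E using Finset.induction with
  | empty =>
    exact ⟨∅, Subset.rfl, by simp, fun W _ => by simpa using W.card_le_univ⟩
  | insert e E he ih =>
    obtain ⟨F, hFE, hreach, hW⟩ := ih
    induction e with
    | _ u v =>
    by_cases huv : (SimpleGraph.fromEdgeSet (F : Set (Sym2 V))).Reachable u v
    · refine ⟨F, hFE.trans (subset_insert _ _), fun a b hab => ?_, hW⟩
      rcases mem_insert.1 hab with h | h
      · rcases Sym2.eq_iff.1 h with ⟨rfl, rfl⟩ | ⟨rfl, rfl⟩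
        exacts [huv, huv.symm]
      · exact hreach a b h
    · have hmono : SimpleGraph.fromEdgeSet (F : Set (Sym2 V)) ≤
          SimpleGraph.fromEdgeSet ((insert s(u, v) F : Finset (Sym2 V)) : Set (Sym2 V)) :=
        SimpleGraph.fromEdgeSet_mono (coe_subset.2 (subset_insert _ _))
      have hne : u ≠ v := by
        rintro rfl
        exact huv .rfl
      have hadj : (SimpleGraph.fromEdgeSet
          ((insert s(u, v) F : Finset (Sym2 V)) : Set (Sym2 V))).Adj u v := by
        simp [hne]
      refine ⟨insert s(u, v) F, insert_subset_insert _ hFE, fun a b hab => ?_, fun W hWs => ?_⟩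
      · rcases mem_insert.1 hab with h | h
        · rcases Sym2.eq_iff.1 h with ⟨rfl, rfl⟩ | ⟨rfl, rfl⟩
          exacts [hadj.reachable, hadj.symm.reachable]
        · exact (hreach a b h).mono hmono
      · have hWF : ∀ a ∈ W, ∀ b ∈ W,
            (SimpleGraph.fromEdgeSet (F : Set (Sym2 V))).Reachable a b → a = b :=
          fun a ha b hb h => hWs a ha b hb (h.mono hmono)
        -- A vertex `c` not connected to `W` can join `W` in the induction hypothesis; this extra
        -- vertex pays for the new edge.
        have key : ∀ c, (∀ w ∈ W, ¬(SimpleGraph.fromEdgeSet (F : Set (Sym2 V))).Reachable w c) →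
            (insert s(u, v) F).card + W.card ≤ Fintype.card V := by
          intro c hc
          have hcW : c ∉ W := fun h => hc c h .rfl
          have := hW (insert c W) (by
            intro a ha b hb hab
            rcases mem_insert.1 ha with ha' | ha' <;> rcases mem_insert.1 hb with hb' | hb'
            · rw [ha', hb']
            · exact (hc b hb' (ha' ▸ hab).symm).elim
            · exact (hc a ha' (hb' ▸ hab)).elim
            · exact hWF a ha' b hb' hab)
          rw [card_insert_of_notMem hcW] at this
          have := card_insert_le s(u, v) F
          omega
        by_cases hu : ∀ w ∈ W, ¬(SimpleGraph.fromEdgeSet (F : Set (Sym2 V))).Reachable w u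
        · exact key u hu
        · push Not at hu
          obtain ⟨w, hw, hwu⟩ := hu
          -- If both `u` and `v` were connected to `W`, the new edge would force the two vertices of
          -- `W` to coincide, and then `u` and `v` were already connected.
          refine key v fun w' hw' hwv => ?_
          have : w = w' := hWs w hw w' hw'
            (((hwu.mono hmono).trans hadj.reachable).trans (hwv.mono hmono).symm)
          subst this
          exact huv (hwu.symm.trans hwv)

variable [Fintype V]

/-- A version of the Tutte–Berge formula: the matching number of `G` is certified by few vertices
and few edges of `G`. -/
theorem exists_coverGraph (G : SimpleGraph V) :
    ∃ (U : Finset V) (F : Finset (Sym2 V)), (F : Set (Sym2 V)) ⊆ G.edgeSet ∧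
      U.card + F.card ≤ 4 * maxMatchingSize G ∧ G ≤ coverGraph U F ∧
      maxMatchingSize (coverGraph U F) ≤ maxMatchingSize G := by
  classical
  -- `K` is an edge-maximal supergraph of `G` with the same matching number; in `K` the Tutte–Berge
  -- structure becomes visible as adjacency.
  obtain ⟨K, hGK, hK⟩ := (Set.toFinite
    {K : SimpleGraph V | maxMatchingSize K ≤ maxMatchingSize G}).exists_le_maximal
    (a := G) (Set.mem_ofPred.2 le_rfl)
  have hKG : maxMatchingSize K = maxMatchingSize G := le_antisymm hK.prop (maxMatchingSize_mono hGK)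
  -- if `a`, `b` are not adjacent in `K` then some maximum matching misses both
  have hmiss : ∀ a b, a ≠ b → ¬K.Adj a b → ∃ S, IsMaxMatching K S ∧
      a ∉ coveredVertices S ∧ b ∉ coveredVertices S := by
    intro a b hab hadj
    have hlt : K < K ⊔ SimpleGraph.edge a b := by
      refine lt_of_le_of_ne le_sup_left fun h => hadj ?_
      rw [h, SimpleGraph.sup_adj]
      exact Or.inr ((SimpleGraph.edge_adj ..).2 ⟨Or.inl ⟨rfl, rfl⟩, hab⟩)
    have hbig : maxMatchingSize K < maxMatchingSize (K ⊔ SimpleGraph.edge a b) := by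
      by_contra hcon
      exact hlt.not_ge (hK.le_of_ge (y := K ⊔ SimpleGraph.edge a b)
        ((not_lt.1 hcon).trans hK.prop) hlt.le)
    -- The larger matching `T` must use the added edge; deleting that edge leaves a maximum matching
    -- of `K` that misses both ends.
    obtain ⟨T, hT, hTc⟩ := exists_isMatchingOf_card_eq (K ⊔ SimpleGraph.edge a b)
    have hT' := isMatchingOf_iff.1 hT
    have hsub : ∀ e ∈ T, e ≠ s(a, b) → e ∈ K.edgeSet := by
      intro e he hne
      have := hT'.1 he
      rw [SimpleGraph.edgeSet_sup] at this
      rcases this with h | h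
      · exact h
      · exact (hne (by simpa [SimpleGraph.edgeSet_edge_of_ne hab] using h)).elim
    have habT : s(a, b) ∈ T := by
      by_contra hn
      have : IsMatchingOf K (T : Set (Sym2 V)) :=
        isMatchingOf_iff.2 ⟨fun e he => hsub e he fun h => hn (h ▸ he), hT'.2⟩
      have := this.card_le
      omega
    have hcov : ∀ c, c ∈ s(a, b) → c ∉ coveredVertices (T.erase s(a, b)) := by
      intro c hc h
      obtain ⟨g, hg, hcg⟩ := mem_coveredVertices.1 h
      exact (mem_erase.1 hg).1 (hT'.2 g (mem_of_mem_erase hg) _ habT c hcg hc)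
    have hTe : IsMatchingOf K ((T.erase s(a, b) : Finset (Sym2 V)) : Set (Sym2 V)) :=
      isMatchingOf_iff.2 ⟨fun e he => hsub e (mem_of_mem_erase he) (mem_erase.1 he).1,
        hT'.2.mono (coe_subset.2 (erase_subset _ _))⟩
    refine ⟨T.erase s(a, b), ⟨hTe, le_antisymm hTe.card_le ?_⟩,
      hcov a (Sym2.mem_mk_left a b), hcov b (Sym2.mem_mk_right a b)⟩
    rw [card_erase_of_mem habT]
    omega
  obtain ⟨M, hM⟩ : ∃ M, IsMaxMatching K M := exists_isMatchingOf_card_eq K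
  set U : Finset V := univ.filter fun v => ∀ S, IsMaxMatching K S → v ∈ coveredVertices S with hU
  have hmemU : ∀ v, v ∈ U ↔ ∀ S, IsMaxMatching K S → v ∈ coveredVertices S := by simp [hU]
  -- adjacency in `K` is transitive outside `U`
  have htrans : ∀ x y z, y ∉ U → x ≠ z → K.Adj x y → K.Adj y z → K.Adj x z := by
    intro x y z hy hxz hxy hyz
    by_contra hn
    obtain ⟨S, hS, hxS, hzS⟩ := hmiss x z hxz hn
    rw [hmemU] at hy
    push Not at hy
    exact hzS (IsMaxMatching.gallai hxz (fun S hS h => hS.covers_of_adj hxy.symm h)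
      (fun S hS h => hS.covers_of_adj hyz h) hy hS hxS)
  -- `F` is a spanning forest of `G` minus `U`. By transitivity its components are cliques of `K`,
  -- so the cover graph lies inside `K`.
  obtain ⟨F, hFE, hreach, hforest⟩ := exists_forest
    (univ.filter fun e : Sym2 V => e ∈ G.edgeSet ∧ ∀ v ∈ e, v ∉ U)
  have hFmem : ∀ e ∈ F, e ∈ G.edgeSet ∧ ∀ v ∈ e, v ∉ U := fun e he => by
    simpa using hFE he
  have hFK : ∀ a b, (SimpleGraph.fromEdgeSet (F : Set (Sym2 V))).Reachable a b →
      a = b ∨ (b ∉ U ∧ K.Adj a b) := by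
    intro a b h
    rw [SimpleGraph.reachable_iff_reflTransGen] at h
    induction h with
    | refl => exact Or.inl rfl
    | @tail b c _ hbc ih =>
      rw [SimpleGraph.fromEdgeSet_adj] at hbc
      obtain ⟨hG, hnU⟩ := hFmem _ hbc.1
      have hcU := hnU c (Sym2.mem_mk_right b c)
      have hbcK : K.Adj b c := hGK hG
      rcases ih with rfl | ⟨hb, hab⟩
      · exact Or.inr ⟨hcU, hbcK⟩
      · by_cases hac : a = c
        · exact Or.inl hac
        · exact Or.inr ⟨hcU, htrans a b c hb hac hab hbcK⟩
  have hUadj : ∀ a b, a ≠ b → a ∈ U → K.Adj a b := by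
    intro a b hab ha
    by_contra hn
    obtain ⟨S, hS, haS, -⟩ := hmiss a b hab hn
    exact haS ((hmemU a).1 ha S hS)
  refine ⟨U, F, fun e he => (hFmem e he).1, ?_, ?_, ?_⟩
  · have h1 : U.card ≤ 2 * maxMatchingSize G := by
      rw [← hKG, ← hM.2, ← hM.1.card_coveredVertices]
      exact card_le_card fun v hv => (hmemU v).1 hv M hM
    -- Vertices missed by `M` are pairwise non-adjacent in `K`, hence lie in distinct components of
    -- `F`; so `F` has at most as many edges as `M` covers vertices.
    have h2 := hforest (coveredVertices M)ᶜ (by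
      intro a ha b hb hab
      rcases hFK a b hab with h | ⟨-, h⟩
      · exact h
      · exact (mem_compl.1 hb (hM.covers_of_adj h (mem_compl.1 ha))).elim)
    rw [card_compl, hM.1.card_coveredVertices, hM.2, hKG] at h2
    have h3 := (coveredVertices M).card_le_univ
    rw [hM.1.card_coveredVertices, hM.2, hKG] at h3
    omega
  · intro a b hab
    refine ⟨hab.ne, ?_⟩
    by_cases ha : a ∈ U
    · exact Or.inl ha
    by_cases hb : b ∈ U
    · exact Or.inr (Or.inl hb)
    refine Or.inr (Or.inr (hreach a b ?_))
    simp only [mem_filter, mem_univ, true_and, SimpleGraph.mem_edgeSet, hab, Sym2.mem_iff]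
    rintro v (rfl | rfl) <;> assumption
  · rw [← hKG]
    refine maxMatchingSize_mono ?_
    rintro a b ⟨hne, h | h | h⟩
    · exact hUadj a b hne h
    · exact (hUadj b a hne.symm h).symm
    · exact (hFK a b h).resolve_left hne |>.2

end Witness

/-! ### Expectation over independent random subsets -/

section RandomSubset

variable {α : Type*} [DecidableEq α] {p : ℝ} {E : Finset α} {f g : Finset α → ℝ}

/-- The expectation of `f F` for the random subset `F` of `E` that contains each element
independently with probability `p`. -/
def randomSubsetMean (p : ℝ) (E : Finset α) (f : Finset α → ℝ) : ℝ :=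
  ∑ F ∈ E.powerset, p ^ F.card * (1 - p) ^ (E \ F).card * f F

lemma randomSubsetMean_empty : randomSubsetMean p ∅ f = f ∅ := by
  simp [randomSubsetMean]

lemma randomSubsetMean_insert {a : α} (ha : a ∉ E) (f : Finset α → ℝ) :
    randomSubsetMean p (insert a E) f =
      (1 - p) * randomSubsetMean p E f + p * randomSubsetMean p E fun F => f (insert a F) := by
  unfold randomSubsetMean
  rw [sum_powerset_insert ha, mul_sum, mul_sum]
  congr 1
  · refine sum_congr rfl fun F hF => ?_
    have haF : a ∉ F := fun h => ha (mem_powerset.1 hF h)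
    rw [insert_sdiff_of_notMem _ haF, card_insert_of_notMem fun h => ha (mem_sdiff.1 h).1, pow_succ]
    ring
  · refine sum_congr rfl fun F hF => ?_
    have haF : a ∉ F := fun h => ha (mem_powerset.1 hF h)
    rw [insert_sdiff_insert, sdiff_insert_of_notMem ha, card_insert_of_notMem haF, pow_succ]
    ring

lemma randomSubsetMean_congr (h : ∀ F ⊆ E, f F = g F) :
    randomSubsetMean p E f = randomSubsetMean p E g :=
  sum_congr rfl fun F hF => by rw [h F (mem_powerset.1 hF)]

lemma randomSubsetMean_mono (hp : 0 ≤ p) (hp1 : p ≤ 1) (h : ∀ F ⊆ E, f F ≤ g F) :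
    randomSubsetMean p E f ≤ randomSubsetMean p E g := by
  refine sum_le_sum fun F hF => mul_le_mul_of_nonneg_left (h F (mem_powerset.1 hF)) ?_
  have := sub_nonneg.2 hp1
  positivity

lemma randomSubsetMean_add :
    randomSubsetMean p E (fun F => f F + g F) =
      randomSubsetMean p E f + randomSubsetMean p E g := by
  simp only [randomSubsetMean, mul_add, sum_add_distrib]

lemma randomSubsetMean_const_mul (c : ℝ) :
    randomSubsetMean p E (fun F => c * f F) = c * randomSubsetMean p E f := by
  simp only [randomSubsetMean, mul_sum]
  exact sum_congr rfl fun F _ => by ring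

lemma randomSubsetMean_sum {ι : Type*} (s : Finset ι) (f : ι → Finset α → ℝ) :
    randomSubsetMean p E (fun F => ∑ i ∈ s, f i F) = ∑ i ∈ s, randomSubsetMean p E (f i) := by
  simp only [randomSubsetMean, mul_sum]
  exact sum_comm

lemma randomSubsetMean_const (c : ℝ) : randomSubsetMean p E (fun _ => c) = c := by
  unfold randomSubsetMean
  rw [← sum_mul]
  have h := sum_pow_mul_eq_add_pow p (1 - p) E
  rw [add_sub_cancel, one_pow] at h
  rw [sum_congr rfl fun F hF => by rw [card_sdiff_of_subset (mem_powerset.1 hF)], h, one_mul]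

/-- Independence in Fubini form: one part of the edges can be fixed while the other is averaged. -/
lemma randomSubsetMean_union {A B : Finset α} (hAB : Disjoint A B) (f : Finset α → ℝ) :
    randomSubsetMean p (A ∪ B) f =
      randomSubsetMean p A fun F₁ => randomSubsetMean p B fun F₂ => f (F₁ ∪ F₂) := by
  induction A using Finset.induction generalizing f with
  | empty => simp [randomSubsetMean_empty]
  | insert a A ha ih =>
    rw [disjoint_insert_left] at hAB
    rw [insert_union, randomSubsetMean_insert (by simp [ha, hAB.1]), randomSubsetMean_insert ha,
      ih hAB.2, ih hAB.2]
    simp only [insert_union]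

/-- The probability that none of the elements of `B ⊆ E` is chosen. -/
lemma randomSubsetMean_disjoint {B : Finset α} (hB : B ⊆ E) :
    randomSubsetMean p E (fun F => if Disjoint F B then 1 else 0) = (1 - p) ^ B.card := by
  suffices h : ∀ E : Finset α, randomSubsetMean p E (fun F => if Disjoint F B then 1 else 0)
      = (1 - p) ^ (E ∩ B).card by
    rw [h, inter_eq_right.2 hB]
  intro E
  induction E using Finset.induction with
  | empty => simp [randomSubsetMean_empty]
  | insert a E ha ih =>
    rw [randomSubsetMean_insert ha, ih]
    by_cases haB : a ∈ B
    · rw [insert_inter_of_mem haB, card_insert_of_notMem fun h => ha (mem_inter.1 h).1]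
      simp only [disjoint_insert_left, haB, not_true_eq_false, false_and, if_false,
        randomSubsetMean_const]
      ring
    · rw [insert_inter_of_notMem haB]
      simp only [disjoint_insert_left, haB, not_false_eq_true, true_and, ih]
      ring

lemma randomSubsetMean_card : randomSubsetMean p E (fun F => (F.card : ℝ)) = p * E.card := by
  induction E using Finset.induction with
  | empty => simp [randomSubsetMean_empty]
  | insert a E ha ih =>
    rw [randomSubsetMean_insert ha, ih, card_insert_of_notMem ha,
      randomSubsetMean_congr (g := fun F => (F.card : ℝ) + 1), randomSubsetMean_add, ih,
      randomSubsetMean_const]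
    · push_cast
      ring
    · intro F hF
      rw [card_insert_of_notMem fun h => ha (hF h)]
      push_cast
      ring

end RandomSubset

/-! ### Expected matching number of a union of edge sets -/

section MatchingNumber

variable {V : Type*} [Fintype V] {p : ℝ}

/-- The matching number of the graph with edge set `F`. -/
noncomputable def matchingNumber (F : Finset (Sym2 V)) : ℕ :=
  maxMatchingSize (SimpleGraph.fromEdgeSet (F : Set (Sym2 V)))

lemma expectedMatchingSize_eq [DecidableEq V] (G : SimpleGraph V) {E : Finset (Sym2 V)}
    (hE : (E : Set (Sym2 V)) = G.edgeSet) (p : ℝ) :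
    expectedMatchingSize G p = randomSubsetMean p E fun F => (matchingNumber F : ℝ) := by
  classical
  have : G.edgeFinset = E := by
    rw [← coe_inj, hE, SimpleGraph.coe_edgeFinset]
  unfold expectedMatchingSize randomSubsetMean matchingNumber
  rw [← this]
  convert rfl

lemma exists_matching (F : Finset (Sym2 V)) :
    ∃ S ⊆ F, (∀ e ∈ S, ¬e.IsDiag) ∧ VertexDisjoint (S : Set (Sym2 V)) ∧
      S.card = matchingNumber F := by
  obtain ⟨S, hS, hc⟩ := exists_isMatchingOf_card_eq (SimpleGraph.fromEdgeSet (F : Set (Sym2 V)))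
  have h := isMatchingOf_iff.1 hS
  rw [SimpleGraph.edgeSet_fromEdgeSet] at h
  exact ⟨S, fun e he => (h.1 he).1, fun e he => (h.1 he).2, h.2, hc⟩

lemma card_le_matchingNumber {S F : Finset (Sym2 V)} (hSF : S ⊆ F) (hd : ∀ e ∈ S, ¬e.IsDiag)
    (hS : VertexDisjoint (S : Set (Sym2 V))) : S.card ≤ matchingNumber F := by
  refine IsMatchingOf.card_le (isMatchingOf_iff.2 ⟨?_, hS⟩)
  rw [SimpleGraph.edgeSet_fromEdgeSet]
  exact fun e he => ⟨hSF he, hd e he⟩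

lemma matchingNumber_mono {F F' : Finset (Sym2 V)} (h : F ⊆ F') :
    matchingNumber F ≤ matchingNumber F' :=
  maxMatchingSize_mono (SimpleGraph.fromEdgeSet_mono (coe_subset.2 h))

variable [DecidableEq V]

lemma matchingNumber_union_le (A B : Finset (Sym2 V)) :
    matchingNumber (A ∪ B) ≤ matchingNumber A + matchingNumber B := by
  obtain ⟨S, hS, hd, hv, hc⟩ := exists_matching (A ∪ B)
  rw [← hc, ← card_inter_add_card_sdiff S A]
  refine add_le_add ?_ ?_
  · exact card_le_matchingNumber inter_subset_right (fun e he => hd e (mem_inter.1 he).1)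
      (hv.mono (coe_subset.2 inter_subset_left))
  · refine card_le_matchingNumber ?_ (fun e he => hd e (mem_sdiff.1 he).1)
      (hv.mono (coe_subset.2 sdiff_subset))
    intro e he
    rw [mem_sdiff] at he
    exact (mem_union.1 (hS he.1)).resolve_left he.2

/-- Removing the unselected part of the graph costs at most its matching number. -/
lemma mean_matchingNumber_union_le (hp : 0 ≤ p) (hp1 : p ≤ 1) {A B : Finset (Sym2 V)}
    (hAB : Disjoint A B) :
    randomSubsetMean p (A ∪ B) (fun F => (matchingNumber F : ℝ)) ≤
      randomSubsetMean p A (fun F => (matchingNumber F : ℝ)) + matchingNumber B := by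
  rw [randomSubsetMean_union hAB, ← randomSubsetMean_const (p := p) (E := A) (matchingNumber B : ℝ),
    ← randomSubsetMean_add]
  refine randomSubsetMean_mono hp hp1 fun F₁ _ => ?_
  rw [← randomSubsetMean_const (p := p) (E := B) ((matchingNumber F₁ : ℝ) + _)]
  refine randomSubsetMean_mono hp hp1 fun F₂ hF₂ => ?_
  exact_mod_cast (matchingNumber_union_le F₁ F₂).trans
    (Nat.add_le_add_left (matchingNumber_mono hF₂) _)

/-- A realized part of a matching `M` can be extended by those edges of a realized matching that
it does not touch. -/
lemma le_mean_matchingNumber_union (hp : 0 ≤ p) (hp1 : p ≤ 1) {M Q : Finset (Sym2 V)}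
    (hMd : ∀ e ∈ M, ¬e.IsDiag) (hM : VertexDisjoint (M : Set (Sym2 V))) (hMQ : Disjoint M Q) :
    p * M.card + (1 - p) ^ 2 * randomSubsetMean p Q (fun F => (matchingNumber F : ℝ)) ≤
      randomSubsetMean p (M ∪ Q) (fun F => (matchingNumber F : ℝ)) := by
  classical
  rw [union_comm, randomSubsetMean_union hMQ.symm, ← randomSubsetMean_const_mul,
    ← randomSubsetMean_const (p := p) (E := Q) (p * M.card), ← randomSubsetMean_add]
  refine randomSubsetMean_mono hp hp1 fun F₂ hF₂ => ?_
  obtain ⟨B, hB, hBd, hBv, hBc⟩ := exists_matching F₂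
  -- `t e` is the set of edges of `M` that block `e`; at most one at each end because `M` is a
  -- matching.
  set t : Sym2 V → Finset (Sym2 V) := fun e => M.filter fun f => ∃ v, v ∈ f ∧ v ∈ e with ht
  have htc : ∀ e, (t e).card ≤ 2 := by
    intro e
    induction e with
    | _ a b =>
    have : t s(a, b) ⊆ (M.filter fun f => a ∈ f) ∪ (M.filter fun f => b ∈ f) := by
      intro f hf
      simp only [ht, mem_filter, Sym2.mem_iff, mem_union] at hf ⊢
      obtain ⟨hfM, v, hv, rfl | rfl⟩ := hf
      exacts [Or.inl ⟨hfM, hv⟩, Or.inr ⟨hfM, hv⟩]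
    have hone : ∀ c : V, (M.filter fun f => c ∈ f).card ≤ 1 := by
      intro c
      rw [card_le_one]
      intro f hf g hg
      rw [mem_filter] at hf hg
      exact hM f hf.1 g hg.1 c hf.2 hg.2
    have h1 := (card_le_card this).trans (card_union_le _ _)
    have h2 := hone a
    have h3 := hone b
    omega
  have hmain : ∀ F₁ ⊆ M, (F₁.card : ℝ) + ∑ e ∈ B, (if Disjoint F₁ (t e) then (1 : ℝ) else 0) ≤
      matchingNumber (F₂ ∪ F₁) := by
    intro F₁ hF₁
    rw [sum_boole]
    set B' := B.filter fun e => Disjoint F₁ (t e) with hB'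
    have hno : ∀ f ∈ F₁, ∀ e ∈ B', ∀ v, v ∈ f → v ∉ e := by
      intro f hf e he v hvf hve
      rw [hB', mem_filter] at he
      exact disjoint_left.1 he.2 hf (mem_filter.2 ⟨hF₁ hf, v, hvf, hve⟩)
    have hdisj : Disjoint F₁ B' := by
      rw [disjoint_left]
      intro f hf hf'
      induction f with
      | _ a b => exact hno _ hf _ hf' a (Sym2.mem_mk_left a b) (Sym2.mem_mk_left a b)
    have := card_le_matchingNumber (S := F₁ ∪ B') (F := F₂ ∪ F₁) ?_ ?_ ?_
    · rw [card_union_of_disjoint hdisj] at this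
      exact_mod_cast this
    · rw [union_comm]
      exact union_subset_union_left ((filter_subset _ _).trans hB)
    · intro e he
      rcases mem_union.1 he with he | he
      exacts [hMd e (hF₁ he), hBd e (mem_filter.1 he).1]
    · intro e he f hf v hve hvf
      rcases mem_union.1 he with he | he <;> rcases mem_union.1 hf with hf | hf
      · exact hM e (hF₁ he) f (hF₁ hf) v hve hvf
      · exact (hno e he f hf v hve hvf).elim
      · exact (hno f hf e he v hvf hve).elim
      · exact hBv e (mem_filter.1 he).1 f (mem_filter.1 hf).1 v hve hvf
  refine le_trans ?_ (randomSubsetMean_mono hp hp1 hmain)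
  rw [randomSubsetMean_add, randomSubsetMean_card, randomSubsetMean_sum, ← hBc]
  gcongr
  rw [mul_comm, ← nsmul_eq_mul]
  refine card_nsmul_le_sum _ _ _ fun e _ => ?_
  rw [randomSubsetMean_disjoint (filter_subset _ _)]
  exact pow_le_pow_of_le_one (sub_nonneg.2 hp1) (by linarith) (htc e)

end MatchingNumber

/-! ### Union bound over certificates -/

section Tail

variable {V : Type*} {p : ℝ}

lemma coverGraph_mono {U U' : Finset V} (h : U ⊆ U') (F : Finset (Sym2 V)) :
    coverGraph U F ≤ coverGraph U' F :=
  fun _ _ hab => ⟨hab.1, hab.2.imp (fun x => h x) (Or.imp (fun x => h x) id)⟩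

variable [Fintype V] [DecidableEq V]

open scoped Classical in
/-- Union bound: if every cover of matching number at most `k` misses at least `b` edges of `Q`,
then a random subset of `Q` is unlikely to have matching number at most `k`. -/
lemma tail_bound (hp : 0 ≤ p) (hp1 : p ≤ 1) {x : ℝ} (hx : 0 < x) (hx1 : x ≤ 1)
    {Q : Finset (Sym2 V)} (hQ : ∀ e ∈ Q, ¬e.IsDiag) (k : ℕ) (b : ℝ)
    (hb : ∀ U F, maxMatchingSize (coverGraph U F) ≤ k →
      b ≤ ((Q.filter fun e => e ∉ (coverGraph U F).edgeSet).card : ℝ)) :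
    randomSubsetMean p Q (fun F => if matchingNumber F ≤ k then 1 else 0) ≤
      (x ^ (4 * k))⁻¹ * Real.exp (3 * x * Q.card) * Real.exp (-(p * b)) := by
  set W := coveredVertices Q with hW
  set A : Finset V → Finset (Sym2 V) → Finset (Sym2 V) := fun U T =>
    Q.filter fun e => e ∉ (coverGraph U T).edgeSet with hA
  set good : Finset V → Finset (Sym2 V) → Prop := fun U T =>
    maxMatchingSize (coverGraph U T) ≤ k with hgood
  -- Instead of counting certificates of size at most 4k, each is weighted by x^(size - 4k), which
  -- is at least 1 on those sizes; the sum then factors.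
  have hpoint : ∀ F ⊆ Q, (if matchingNumber F ≤ k then (1 : ℝ) else 0) ≤
      ∑ U ∈ W.powerset, ∑ T ∈ Q.powerset, (x ^ (4 * k))⁻¹ * (x ^ U.card * x ^ T.card) *
        if good U T ∧ Disjoint F (A U T) then 1 else 0 := by
    intro F hF
    have hnn : ∀ U ∈ W.powerset, ∀ T ∈ Q.powerset,
        0 ≤ (x ^ (4 * k))⁻¹ * (x ^ U.card * x ^ T.card) *
          if good U T ∧ Disjoint F (A U T) then (1 : ℝ) else 0 := by
      intro U _ T _
      split_ifs <;> positivity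
    split_ifs with hk
    · obtain ⟨U, T, hT, hc, hle, hnu⟩ :=
        exists_coverGraph (SimpleGraph.fromEdgeSet (F : Set (Sym2 V)))
      have hTF : T ⊆ F := fun e he => by
        have := hT he
        rw [SimpleGraph.edgeSet_fromEdgeSet] at this
        exact this.1
      -- Vertices outside `W` meet no edge of `Q`. Discarding them makes the union bound depend on
      -- `Q` only, not on the order of the graph.
      have hUW : U ∩ W ∈ W.powerset := mem_powerset.2 inter_subset_right
      have hTQ : T ∈ Q.powerset := mem_powerset.2 (hTF.trans hF)
      refine le_trans ?_ (single_le_sum (fun U hU => sum_nonneg (hnn U hU)) hUW)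
      refine le_trans ?_ (single_le_sum (hnn _ hUW) hTQ)
      have hg : good (U ∩ W) T :=
        ((maxMatchingSize_mono (coverGraph_mono inter_subset_left T)).trans hnu).trans hk
      have hd : Disjoint F (A (U ∩ W) T) := by
        rw [disjoint_left]
        intro e he heA
        rw [hA, mem_filter] at heA
        refine heA.2 ?_
        have hmem : ∀ v ∈ e, v ∈ W := fun v hv => mem_coveredVertices.2 ⟨e, hF he, hv⟩
        have hnd := hQ e (hF he)
        induction e with
        | _ u v =>
        have hadj : (coverGraph U T).Adj u v := hle (by
          rw [SimpleGraph.fromEdgeSet_adj]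
          exact ⟨he, fun h => hnd (by simpa using h)⟩)
        exact ⟨hadj.1, hadj.2.imp
          (fun h => mem_inter.2 ⟨h, hmem u (Sym2.mem_mk_left u v)⟩)
          (Or.imp (fun h => mem_inter.2 ⟨h, hmem v (Sym2.mem_mk_right u v)⟩) id)⟩
      rw [if_pos ⟨hg, hd⟩, mul_one, ← pow_add, ← div_eq_inv_mul, one_le_div (by positivity)]
      refine pow_le_pow_of_le_one hx.le hx1 ?_
      have h1 : (U ∩ W).card ≤ U.card := card_le_card inter_subset_left
      have h2 : matchingNumber F ≤ k := hk
      unfold matchingNumber at h2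
      omega
    · exact sum_nonneg fun U hU => sum_nonneg (hnn U hU)
  have hprob : ∀ U T, randomSubsetMean p Q
      (fun F => if good U T ∧ Disjoint F (A U T) then 1 else 0) ≤ Real.exp (-(p * b)) := by
    intro U T
    by_cases hg : good U T
    · simp only [hg, true_and]
      rw [randomSubsetMean_disjoint (filter_subset _ _)]
      calc (1 - p) ^ (A U T).card ≤ Real.exp (-p) ^ (A U T).card := by
            have := Real.add_one_le_exp (-p)
            exact pow_le_pow_left₀ (sub_nonneg.2 hp1) (by linarith) _
        _ = Real.exp (-(p * (A U T).card)) := by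
            rw [← Real.exp_nat_mul]
            ring_nf
        _ ≤ _ := Real.exp_le_exp.2 (neg_le_neg (mul_le_mul_of_nonneg_left (hb U T hg) hp))
    · simp only [hg, false_and, if_false, randomSubsetMean_const]
      positivity
  have hexp : ∀ {β : Type _} (s : Finset β) (n : ℝ), (s.card : ℝ) ≤ n →
      ∑ U ∈ s.powerset, x ^ U.card ≤ Real.exp (x * n) := by
    intro β s n hn
    have h := sum_pow_mul_eq_add_pow x 1 s
    simp only [one_pow, mul_one] at h
    rw [h]
    calc (x + 1) ^ s.card ≤ Real.exp x ^ s.card :=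
          pow_le_pow_left₀ (by positivity) (Real.add_one_le_exp x) _
      _ = Real.exp (x * s.card) := by rw [← Real.exp_nat_mul, mul_comm]
      _ ≤ _ := Real.exp_le_exp.2 (mul_le_mul_of_nonneg_left hn hx.le)
  calc randomSubsetMean p Q (fun F => if matchingNumber F ≤ k then 1 else 0)
      ≤ _ := randomSubsetMean_mono hp hp1 hpoint
    _ = ∑ U ∈ W.powerset, ∑ T ∈ Q.powerset, (x ^ (4 * k))⁻¹ * (x ^ U.card * x ^ T.card) *
          randomSubsetMean p Q (fun F => if good U T ∧ Disjoint F (A U T) then 1 else 0) := by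
        simp only [randomSubsetMean_sum, randomSubsetMean_const_mul]
    _ ≤ ∑ U ∈ W.powerset, ∑ T ∈ Q.powerset, (x ^ (4 * k))⁻¹ * (x ^ U.card * x ^ T.card) *
          Real.exp (-(p * b)) := by
        gcongr with U _ T _
        exact hprob U T
    _ = (x ^ (4 * k))⁻¹ * ((∑ U ∈ W.powerset, x ^ U.card) * ∑ T ∈ Q.powerset, x ^ T.card) *
          Real.exp (-(p * b)) := by
        rw [sum_mul_sum]
        simp only [mul_sum, sum_mul]
    _ ≤ (x ^ (4 * k))⁻¹ * (Real.exp (x * (2 * Q.card)) * Real.exp (x * Q.card)) *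
          Real.exp (-(p * b)) := by
        gcongr
        · exact hexp W _ (by exact_mod_cast card_coveredVertices_le Q)
        · exact hexp Q _ le_rfl
    _ = _ := by
        rw [← Real.exp_add]
        ring_nf

end Tail

/-! ### Numerical estimate for the number of rounds -/

section Rounds

/-- The number of rounds is large enough for the union bound over all covers. -/
lemma rounds_estimate {C ε p T : ℝ} (hC : 1000 ≤ C) (hε : 0 < ε) (hε1 : ε ≤ 1 / 10 ^ 4)
    (hp : 0 < p) (hp1 : p ≤ 1) (hT : 0 ≤ T) :
    1 ≤ matchingCoverRounds C ε p ∧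
    4 * T * Real.log (matchingCoverRounds C ε p / p) + 3 * T
      - p * (matchingCoverRounds C ε p * max 1 (ε * T)) ≤ Real.log (ε * p) := by
  set l := Real.log (1 / (ε * p)) with hl
  have hεp : 0 < ε * p := by positivity
  have hεp1 : ε * p ≤ 1 / 10 ^ 4 := by nlinarith
  have hexpl : Real.exp l = 1 / (ε * p) := Real.exp_log (by positivity)
  have hl1 : 1 ≤ l := by
    rw [hl, Real.le_log_iff_exp_le (by positivity), le_div_iff₀ hεp]
    have := Real.exp_one_lt_d9
    nlinarith [Real.exp_pos 1]
  set y := C * (l / (ε * p)) with hy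
  have hy1 : 1 ≤ y := by
    have : 1 ≤ l / (ε * p) := by
      rw [le_div_iff₀ hεp]
      linarith
    nlinarith
  set R : ℝ := (matchingCoverRounds C ε p : ℝ) with hR
  have hRy : y ≤ R := Nat.le_ceil _
  have hR2 : R ≤ 2 * y := by
    have : R < y + 1 := Nat.ceil_lt_add_one (by linarith)
    linarith
  have hRpos : 0 < R := by linarith
  refine ⟨?_, ?_⟩
  · have : (1 : ℝ) ≤ matchingCoverRounds C ε p := hy1.trans hRy
    exact_mod_cast this
  -- `R` grows with `C`, which is unbounded; the slope 1/100 keeps this logarithm below the gain,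
  -- which is linear in `C`.
  have hlog : Real.log (R / p) ≤ C / 100 + 7 + 3 * l := by
    rw [Real.log_le_iff_le_exp (by positivity)]
    have h1 : 2 * C ≤ Real.exp (C / 100 + 7) := by
      rw [Real.exp_add]
      have h7 : (200 : ℝ) ≤ Real.exp 7 := by
        have : Real.exp 7 = Real.exp 1 ^ 7 := by
          rw [← Real.exp_nat_mul]
          norm_num
        have h3 : (2.7 : ℝ) ≤ Real.exp 1 := by
          have := Real.exp_one_gt_d9
          linarith
        calc (200 : ℝ) ≤ 2.7 ^ 7 := by norm_num
          _ ≤ _ := by rw [this]; gcongr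
      have h8 := Real.add_one_le_exp (C / 100)
      nlinarith
    have h2 : l ≤ Real.exp l := by
      have := Real.add_one_le_exp l
      linarith
    have h3 : 1 / p ≤ Real.exp l := by
      rw [hexpl]
      exact one_div_le_one_div_of_le hεp (by nlinarith)
    calc R / p ≤ 2 * y / p := by gcongr
      _ = 2 * C * (l * (1 / (ε * p)) * (1 / p)) := by rw [hy]; ring
      _ ≤ Real.exp (C / 100 + 7) * (Real.exp l * Real.exp l * Real.exp l) := by
          rw [← hexpl]
          gcongr
      _ = _ := by
          rw [← Real.exp_add, ← Real.exp_add, ← Real.exp_add]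
          ring_nf
  have hneg : Real.log (ε * p) = -l := by
    rw [hl, one_div, Real.log_inv, neg_neg]
  rw [hneg]
  -- Using T + 1 rather than T retains a term `C * l / 2` for small `T`, which pays for the failure
  -- probability `ε * p`.
  have hmax : C * l * ((T + 1) / 2) ≤ p * (R * max 1 (ε * T)) := by
    have hm : ε * ((T + 1) / 2) ≤ max 1 (ε * T) := by
      have h1 := le_max_left 1 (ε * T)
      have h2 := le_max_right 1 (ε * T)
      nlinarith
    calc C * l * ((T + 1) / 2) = p * (y * (ε * ((T + 1) / 2))) := by
          rw [hy]
          field_simp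
      _ ≤ _ := by gcongr
  have hfin : 4 * (C / 100 + 7 + 3 * l) + 3 ≤ C * l / 2 := by nlinarith
  have h4 : 4 * T * Real.log (R / p) ≤ 4 * T * (C / 100 + 7 + 3 * l) := by gcongr
  nlinarith [mul_le_mul_of_nonneg_left hfin hT]

end Rounds

/-! ### The matching cover lemma -/

section MatchingCover

variable {V : Type*} [Fintype V] [DecidableEq V]

/-- **Matching cover lemma**: the realized union of sufficiently many edge-disjoint matchings of
size at least `L` contains in expectation a matching of size almost `min L T`. -/
theorem le_mean_matchingNumber_biUnion {C ε p T : ℝ} (hC : 1000 ≤ C) (hε : 0 < ε)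
    (hε1 : ε ≤ 1 / 10 ^ 4) (hp : 0 < p) (hp1 : p ≤ 1) {L m : ℕ} (hmT : p * m ≤ T)
    {N : Fin (matchingCoverRounds C ε p) → Finset (Sym2 V)} (hd : ∀ i, ∀ e ∈ N i, ¬e.IsDiag)
    (hv : ∀ i, VertexDisjoint (N i : Set (Sym2 V))) (hN : ∀ i j, i ≠ j → Disjoint (N i) (N j))
    (hL : ∀ i, L ≤ (N i).card) (hm : ∀ i, (N i).card ≤ m) :
    min (L : ℝ) T - 2 * ε * T ≤
      randomSubsetMean p (univ.biUnion N) (fun F => (matchingNumber F : ℝ)) := by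
  classical
  have hT : 0 ≤ T := le_trans (by positivity) hmT
  obtain ⟨hR1, hround⟩ := rounds_estimate hC hε hε1 hp hp1 hT
  generalize matchingCoverRounds C ε p = R at N hd hv hN hL hm hR1 hround ⊢
  have hR1' : (1 : ℝ) ≤ R := by exact_mod_cast hR1
  set Q := univ.biUnion N with hQ
  set a := min (L : ℝ) T - ε * T with ha
  have hεT : 0 ≤ ε * T := by positivity
  rcases le_or_gt a 0 with ha0 | ha0
  · refine le_trans (by linarith) (le_trans (randomSubsetMean_const 0).ge
      (randomSubsetMean_mono hp.le hp1 fun F _ => Nat.cast_nonneg _))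
  have haL : a ≤ L - ε * T := by linarith [min_le_left (L : ℝ) T]
  have haT : a ≤ T := by linarith [min_le_right (L : ℝ) T]
  -- `k` is the largest natural number strictly below `a`, so matching number at most `k` is exactly
  -- failure to reach `a`.
  obtain ⟨k, hk⟩ : ∃ k, ⌈a⌉₊ = k + 1 := Nat.exists_eq_succ_of_ne_zero (Nat.ceil_pos.2 ha0).ne'
  have hka : (k : ℝ) < a := Nat.lt_ceil.1 (by omega)
  have hkL : k + 1 ≤ L := by
    have : (k : ℝ) < L := by linarith
    exact_mod_cast this
  have hQd : ∀ e ∈ Q, ¬e.IsDiag := by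
    intro e he
    obtain ⟨i, -, hi⟩ := mem_biUnion.1 he
    exact hd i e hi
  have hQc : (Q.card : ℝ) ≤ R * m := by
    have : Q.card ≤ R * m := by
      simpa using card_biUnion_le_card_mul univ N m fun i _ => hm i
    exact_mod_cast this
  have hmiss : ∀ U F, maxMatchingSize (coverGraph U F) ≤ k →
      (R : ℝ) * max 1 (ε * T) ≤
        ((Q.filter fun e => e ∉ (coverGraph U F).edgeSet).card : ℝ) := by
    intro U F hUF
    have h1 : ∀ i, max 1 (ε * T) ≤
        (((N i).filter fun e => e ∉ (coverGraph U F).edgeSet).card : ℝ) := by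
      intro i
      have hcov : ((N i).filter fun e => e ∈ (coverGraph U F).edgeSet).card ≤ k := by
        refine (IsMatchingOf.card_le (isMatchingOf_iff.2 ⟨?_, ?_⟩)).trans hUF
        · exact fun e he => (mem_filter.1 he).2
        · exact (hv i).mono (coe_subset.2 (filter_subset _ _))
      have hsum := card_filter_add_card_filter_not (s := N i)
        (fun e => e ∈ (coverGraph U F).edgeSet)
      have hLi := hL i
      have h2 : L ≤ k + ((N i).filter fun e => e ∉ (coverGraph U F).edgeSet).card := by omega
      refine max_le ?_ ?_
      · have : 1 ≤ ((N i).filter fun e => e ∉ (coverGraph U F).edgeSet).card := by omega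
        exact_mod_cast this
      · have : (L : ℝ) ≤ k + ((N i).filter fun e => e ∉ (coverGraph U F).edgeSet).card := by
          exact_mod_cast h2
        linarith
    rw [hQ, filter_biUnion, card_biUnion]
    · push_cast
      have := card_nsmul_le_sum univ
        (fun i => (((N i).filter fun e => e ∉ (coverGraph U F).edgeSet).card : ℝ)) _
        fun i _ => h1 i
      simpa using this
    · intro i _ j _ hij
      exact disjoint_filter_filter (hN i j hij)
  -- The weight x = p/R balances the union bound: `Q` has at most `R * m` edges, so exp(3x|Q|) ≤
  -- exp(3pm) ≤ exp(3T), while x^(-4k) costs at most exp(4T log(R/p)).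
  have hx : 0 < p / R := by positivity
  have hx1 : p / R ≤ 1 := by
    rw [div_le_one (by positivity)]
    linarith
  have hlog : 0 ≤ Real.log (R / p) :=
    Real.log_nonneg (by rw [le_div_iff₀ hp]; linarith)
  have htail : randomSubsetMean p Q (fun F => if matchingNumber F ≤ k then (1 : ℝ) else 0) ≤
      ε * p := by
    refine (tail_bound hp.le hp1 hx hx1 hQd k _ hmiss).trans ?_
    have h1 : (((p / R) ^ (4 * k))⁻¹ : ℝ) ≤ Real.exp (4 * T * Real.log (R / p)) := by
      rw [← inv_pow, inv_div, ← Real.exp_log (show (0 : ℝ) < R / p by positivity),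
        ← Real.exp_nat_mul, Real.log_exp]
      refine Real.exp_le_exp.2 (mul_le_mul_of_nonneg_right ?_ hlog)
      push_cast
      linarith
    have h2 : 3 * (p / R) * Q.card ≤ 3 * T := by
      calc 3 * (p / R) * Q.card ≤ 3 * (p / R) * (R * m) := by gcongr
        _ = 3 * (p * m) := by field_simp
        _ ≤ _ := by linarith
    calc _ ≤ Real.exp (4 * T * Real.log (R / p)) * Real.exp (3 * T) *
          Real.exp (-(p * (R * max 1 (ε * T)))) := by gcongr
      _ = Real.exp (4 * T * Real.log (R / p) + 3 * T - p * (R * max 1 (ε * T))) := by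
          rw [← Real.exp_add, ← Real.exp_add, sub_eq_add_neg]
      _ ≤ Real.exp (Real.log (ε * p)) := Real.exp_le_exp.2 hround
      _ = ε * p := Real.exp_log (by positivity)
  have hlow : a + -a * randomSubsetMean p Q
      (fun F => if matchingNumber F ≤ k then (1 : ℝ) else 0) ≤
      randomSubsetMean p Q (fun F => (matchingNumber F : ℝ)) := by
    rw [← randomSubsetMean_const_mul, ← randomSubsetMean_const (p := p) (E := Q) a,
      ← randomSubsetMean_add, randomSubsetMean_const]
    refine randomSubsetMean_mono hp.le hp1 fun F _ => ?_
    split_ifs with hF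
    · have : (0 : ℝ) ≤ matchingNumber F := Nat.cast_nonneg _
      linarith
    · have : ⌈a⌉₊ ≤ matchingNumber F := by omega
      have := Nat.ceil_le.1 this
      linarith
  have h1 : a * randomSubsetMean p Q
      (fun F => if matchingNumber F ≤ k then (1 : ℝ) else 0) ≤ T * (ε * 1) :=
    (mul_le_mul_of_nonneg_left htail ha0.le).trans (by gcongr)
  linarith

end MatchingCover

/-! ### Balancing the bounds and conclusion -/

/-- Balancing the two lower bounds on the expected matching size of the algorithm's output. -/
lemma approximation_ratio {p ε T Y L B m : ℝ} (hp : 0 ≤ p) (hp1 : p ≤ 1) (hε : 0 ≤ ε)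
    (hε1 : ε ≤ 1 / 10 ^ 4) (hT : 0 ≤ T) (hTm : T ≤ m) (hB : min L T - 2 * ε * T ≤ B)
    (h1 : T ≤ Y + L) (h2 : p * m + (1 - p) ^ 2 * B ≤ Y) :
    (1 / 2 + p ^ 2 / 4 - ε) * T ≤ Y := by
  set q := (1 - p) ^ 2 with hq
  have hq0 : 0 ≤ q := sq_nonneg _
  have hq1 : q ≤ 1 := by rw [hq]; nlinarith
  have h3 : p * T + q * (min L T - 2 * ε * T) ≤ Y :=
    le_trans (add_le_add (mul_le_mul_of_nonneg_left hTm hp) (mul_le_mul_of_nonneg_left hB hq0)) h2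
  have h4 : 0 ≤ (1 - q) * ε := mul_nonneg (by linarith) hε
  rcases le_total L T with h | h
  · rw [min_eq_left h] at h3
    have h5 : q * T ≤ q * (Y + L) := mul_le_mul_of_nonneg_left h1 hq0
    -- The source of p²/4: p + q = (1 + q)/2 + p²/2, and 1 + q ≤ 2 turns p²/2 into at least (1 +
    -- q)p²/4.
    have h6 : (1 + q) * (1 / 2 + p ^ 2 / 4 - ε) ≤ p + q - 2 * ε * q := by
      have : 0 ≤ (1 - q) * p ^ 2 := mul_nonneg (by linarith) (sq_nonneg p)
      rw [hq] at *
      nlinarith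
    have h7 := mul_le_mul_of_nonneg_right h6 hT
    nlinarith
  · rw [min_eq_right h] at h3
    have h6 : 1 / 2 + p ^ 2 / 4 - ε ≤ p + q * (1 - 2 * ε) := by
      rw [hq] at *
      nlinarith [sq_nonneg (1 - 2 * p)]
    have h7 := mul_le_mul_of_nonneg_right h6 hT
    nlinarith

theorem mainTheorem4 :
    ∃ C₀ : ℝ, 0 < C₀ ∧ ∀ C : ℝ, C₀ ≤ C →
      ∀ p₀ p : ℝ, 0 < p₀ → p₀ ≤ p → p ≤ 1 →
        ∀ (V : Type*) [Fintype V] (G H : SimpleGraph V),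
          IsAlgorithmOutput C p₀ p G H →
            (1 / 2 + p ^ 2 / 4 - p₀ ^ 2 / 10 ^ 4) * expectedMatchingSize G p ≤
              expectedMatchingSize H p := by
  classical
  refine ⟨1000, by norm_num, fun C hC p₀ p hp₀ hpp hp1 V _ G H ⟨M, N, hM, hN, hH⟩ => ?_⟩
  have hp : 0 < p := hp₀.trans_le hpp
  have hε : 0 < p₀ ^ 2 / 10 ^ 4 := by positivity
  have hε1 : p₀ ^ 2 / 10 ^ 4 ≤ 1 / 10 ^ 4 := by
    have : p₀ ≤ 1 := hpp.trans hp1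
    gcongr
    nlinarith
  generalize p₀ ^ 2 / 10 ^ 4 = ε at N hN hH hε hε1 ⊢
  lift M to Finset (Sym2 V) using Set.toFinite M
  obtain ⟨N, rfl⟩ : ∃ N' : Fin (matchingCoverRounds C ε p) → Finset (Sym2 V),
      N = fun i => (N' i : Set (Sym2 V)) :=
    ⟨fun i => (Set.toFinite (N i)).toFinset, by simp⟩
  have hM' := isMatchingOf_iff.1 hM.1
  have hN' := fun i => isMatchingOf_iff.1 (hN i).1
  simp only [SimpleGraph.edgeSet_deleteEdges] at hN'
  have hNG : ∀ i, ∀ e ∈ N i, e ∈ G.edgeSet := fun i e he => ((hN' i).1 he).1.1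
  have hNM : ∀ i, ∀ e ∈ N i, e ∉ M := fun i e he => ((hN' i).1 he).1.2
  have hlt : ∀ i j, j < i → Disjoint (N i) (N j) := by
    intro i j hji
    rw [disjoint_left]
    intro e hei hej
    exact ((hN' i).1 hei).2 (Set.mem_iUnion₂.2 ⟨j, hji, hej⟩)
  have hdisj : ∀ i j, i ≠ j → Disjoint (N i) (N j) := by
    intro i j hij
    rcases lt_or_gt_of_ne hij with h | h
    exacts [(hlt j i h).symm, hlt i j h]
  set Q := univ.biUnion N with hQ
  have hMQ : Disjoint M Q := by
    rw [disjoint_left]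
    intro e heM heQ
    obtain ⟨i, -, hi⟩ := mem_biUnion.1 heQ
    exact hNM i e hi heM
  have hEH : ((M ∪ Q : Finset (Sym2 V)) : Set (Sym2 V)) = H.edgeSet := by
    rw [hH, SimpleGraph.edgeSet_fromEdgeSet, coe_union, hQ, coe_biUnion]
    simp only [coe_univ, Set.mem_univ, Set.iUnion_true]
    symm
    rw [sdiff_eq_left, Set.disjoint_left]
    rintro e (he | he)
    · exact G.not_isDiag_of_mem_edgeSet (hM'.1 he)
    · obtain ⟨i, hi⟩ := Set.mem_iUnion.1 he
      exact G.not_isDiag_of_mem_edgeSet (hNG i e hi)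
  set D := G.edgeFinset \ (M ∪ Q) with hD
  have hMQG : M ∪ Q ⊆ G.edgeFinset := by
    intro e he
    rw [SimpleGraph.mem_edgeFinset]
    rcases mem_union.1 he with he | he
    · exact hM'.1 he
    · obtain ⟨i, -, hi⟩ := mem_biUnion.1 he
      exact hNG i e hi
  have hEG : (((M ∪ Q) ∪ D : Finset (Sym2 V)) : Set (Sym2 V)) = G.edgeSet := by
    rw [hD, union_sdiff_of_subset hMQG, SimpleGraph.coe_edgeFinset]
  have hMm : M.card = maxMatchingSize G := by
    rw [← hM.ncard_eq, Set.ncard_coe_finset]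
  have hle : ∀ F ⊆ G.edgeFinset, matchingNumber F ≤ M.card := by
    intro F hF
    rw [hMm]
    refine maxMatchingSize_mono ?_
    rw [← G.fromEdgeSet_edgeSet]
    exact SimpleGraph.fromEdgeSet_mono fun e he => SimpleGraph.mem_edgeFinset.1 (hF he)
  have hTm : expectedMatchingSize G p ≤ M.card := by
    rw [expectedMatchingSize_eq G hEG, ← randomSubsetMean_const (p := p) (E := M ∪ Q ∪ D)
      (M.card : ℝ)]
    refine randomSubsetMean_mono hp.le hp1 fun F hF => ?_
    rw [hD, union_sdiff_of_subset hMQG] at hF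
    exact_mod_cast hle F hF
  have hMd : ∀ e ∈ M, ¬e.IsDiag := fun e he => G.not_isDiag_of_mem_edgeSet (hM'.1 he)
  have hMG : Disjoint M (G.edgeFinset \ M) := disjoint_sdiff
  -- The realized part of `M` alone is a matching; this bounds the size of every cover matching by
  -- T/p.
  have hpm : p * M.card ≤ expectedMatchingSize G p := by
    have h := le_mean_matchingNumber_union hp.le hp1 hMd hM'.2 hMG
    rw [union_sdiff_of_subset (union_subset_left hMQG)] at h
    rw [expectedMatchingSize_eq G (SimpleGraph.coe_edgeFinset G)]
    refine le_trans (le_add_of_nonneg_right (mul_nonneg (sq_nonneg _) ?_)) h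
    exact le_trans (randomSubsetMean_const 0).ge
      (randomSubsetMean_mono hp.le hp1 fun F _ => Nat.cast_nonneg _)
  have hT : 0 ≤ expectedMatchingSize G p := le_trans (by positivity) hpm
  have hR := (rounds_estimate hC hε hε1 hp hp1 hT).1
  set last : Fin (matchingCoverRounds C ε p) := ⟨matchingCoverRounds C ε p - 1, by omega⟩ with hlast
  -- The graphs of the rounds shrink, so the last matching was also a candidate in every earlier
  -- round.
  have hL : ∀ i, (N last).card ≤ (N i).card := by
    intro i
    have hil : i ≤ last := Fin.le_def.2 (by have := i.2; simp only [hlast]; omega)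
    have h := (hN i).2 (N last) ((hN last).1.mono ?_)
    · simpa [Set.ncard_coe_finset] using h
    · refine SimpleGraph.deleteEdges_anti ?_
      exact Set.iUnion₂_subset fun j hj => Set.subset_iUnion₂_of_subset j (hj.trans_le hil)
        Set.Subset.rfl
  have hm : ∀ i, (N i).card ≤ M.card := by
    intro i
    rw [hMm]
    exact IsMatchingOf.card_le (isMatchingOf_iff.2 ⟨hNG i, (hN' i).2⟩)
  -- Unselected edges avoid `M` and all cover matchings, so a matching of `D` competes with `N last`
  -- in the last round.
  have hDL : matchingNumber D ≤ (N last).card := by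
    obtain ⟨S, hSD, -, hSv, hSc⟩ := exists_matching D
    have h := (hN last).2 S (isMatchingOf_iff.2 ⟨?_, hSv⟩)
    · rw [← hSc]
      simpa [Set.ncard_coe_finset] using h
    · intro e he
      have heD := hSD he
      rw [hD, mem_sdiff, mem_union, not_or, SimpleGraph.mem_edgeFinset] at heD
      simp only [SimpleGraph.edgeSet_deleteEdges]
      refine ⟨⟨heD.1, heD.2.1⟩, fun hU => ?_⟩
      obtain ⟨j, -, hj⟩ := Set.mem_iUnion₂.1 hU
      exact heD.2.2 (mem_biUnion.2 ⟨j, mem_univ _, hj⟩)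
  have hcover := le_mean_matchingNumber_biUnion hC hε hε1 hp hp1 hpm
    (fun i e he => G.not_isDiag_of_mem_edgeSet (hNG i e he)) (fun i => (hN' i).2) hdisj hL hm
  have h1 := mean_matchingNumber_union_le hp.le hp1 (A := M ∪ Q) (B := D) disjoint_sdiff
  have h2 := le_mean_matchingNumber_union hp.le hp1 hMd hM'.2 hMQ
  rw [← expectedMatchingSize_eq G hEG, ← expectedMatchingSize_eq H hEH] at h1
  rw [← expectedMatchingSize_eq H hEH] at h2
  have hDL' : (matchingNumber D : ℝ) ≤ (N last).card := by exact_mod_cast hDL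
  exact approximation_ratio hp.le hp1 hε.le hε1 hT hTm hcover (h1.trans (by linarith)) h2
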